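/- Let $G$ be an infinite, connected, locally finite simple graph that is $d$-regular and quasi-transitive, i.e. the group of automorphisms of $G$ acts on the vertices of $G$ with finitely many orbits. Consider Bernoulli bond percolation on $G$ with parameter $p \in [0,1]$ (each edge is retained with probability $p$ and deleted with probability $1-p$, independently of all other edges), let $\psi(p)$ be the probability that the retained edges form a graph with an infinite connected component, and let $p_c(G) = \sup\{p \in [0,1] : \psi(p) = 0\}$. Then $$p_c(G) \ge \frac{1}{d-1},$$ and $p_c(G) = \frac{1}{d-1}$ if and only if $G$ is a tree. -/

import Mathlib

/-- A graph is quasi-transitive if the action of its automorphism group `G ≃g G` on the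
vertex set has finitely many orbits. -/
def SimpleGraph.IsQuasiTransitive {V : Type*} (G : SimpleGraph V) : Prop :=
  Finite (MulAction.orbitRel.Quotient (G ≃g G) V)

namespace BondPercolation

open MeasureTheory ProbabilityTheory unitInterval

variable {V : Type*} (G : SimpleGraph V)

/-- The law of Bernoulli bond percolation on `G` with parameter `p`: each edge of `G` is,
independently of all the others, open (`true`) with probability `p` and closed (`false`) with probability
`1 - p`. -/
noncomputable def percMeasure (p : I) : Measure (G.edgeSet → Bool) :=
  Measure.infinitePi fun _ : G.edgeSet ↦ bernoulliMeasure true false p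

/-- The random subgraph of `G` that has all the vertices and only the open edges. -/
def openSubgraph (ω : G.edgeSet → Bool) : SimpleGraph V :=
  SimpleGraph.fromEdgeSet {e | ∃ h : e ∈ G.edgeSet, ω ⟨e, h⟩ = true}

/-- The event that some connected component of the open subgraph is infinite. -/
def existsInfiniteCluster : Set (G.edgeSet → Bool) :=
  {ω | ∃ C : (openSubgraph G ω).ConnectedComponent, C.supp.Infinite}

/-- The probability `ψ(p)` that there is an infinite open component. -/
noncomputable def percProb (p : I) : ℝ :=
  (percMeasure G p).real (existsInfiniteCluster G)

/-- The critical parameter `p_c = sup {p ∈ [0, 1] : ψ(p) = 0}`. -/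
noncomputable def criticalThreshold : ℝ :=
  sSup {p : ℝ | ∃ hp : p ∈ I, percProb G ⟨p, hp⟩ = 0}

end BondPercolation

namespace BondPercolation

open MeasureTheory ProbabilityTheory unitInterval

variable {V : Type*} {G : SimpleGraph V}

/-! The expected number of open self-avoiding walks with `k` steps from `v` is at most `d * (d - 1)
^ (k - 1) * p ^ k`, while an infinite cluster yields such walks of every length. So nothing
percolates below `1 / (d - 1)`.

If `G` has a cycle, quasi-transitivity makes the loss uniform: for some `N`, every oriented edge has
fewer than `(d - 1) ^ N` self-avoiding prolongations (`exists_sawCount_lt`). By submultiplicativity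
the growth rate drops below `d - 1`, so the threshold is strictly larger. The crux is `not_isFree`:
an oriented edge with no loss at any length would pass this property on to whole balls, and so to a
vertex on a cycle.

On a tree, an oriented edge starts a branching process with mean offspring `(d - 1) * p`. Disjoint
branches are independent, and the recursion for survival probabilities keeps them bounded below when
the mean exceeds 1 (`le_measure_reachesDepth`). -/

open scoped Classical in
/-- The number of ways to prolong the self-avoiding walk `l` (listed from its last vertex to its
first one) by `k` further steps. -/
noncomputable def sawCount (G : SimpleGraph V) [G.LocallyFinite] : ℕ → List V → ℕ
  | 0, _ => 1
  | _ + 1, [] => 0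
  | k + 1, y :: l => ∑ z ∈ G.neighborFinset y with z ∉ y :: l, sawCount G k (z :: y :: l)

/-! ### Counting self-avoiding walks. -/

section Counting

variable [G.LocallyFinite]

@[simp]
lemma sawCount_zero (l : List V) : sawCount G 0 l = 1 := by
  simp [sawCount]

open scoped Classical in
lemma sawCount_succ (k : ℕ) (y : V) (l : List V) :
    sawCount G (k + 1) (y :: l) =
      ∑ z ∈ G.neighborFinset y with z ∉ y :: l, sawCount G k (z :: y :: l) := rfl

/-- Forgetting the oldest vertices only removes constraints. Hence bounds that depend on the last
oriented edge alone suffice. -/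
lemma sawCount_append_le (k : ℕ) (y : V) (l r : List V) :
    sawCount G k (y :: l ++ r) ≤ sawCount G k (y :: l) := by
  classical
  induction k generalizing y l with
  | zero => simp
  | succ k ih =>
    rw [List.cons_append, sawCount_succ, sawCount_succ]
    refine (Finset.sum_le_sum fun z _ ↦ ih z (y :: l)).trans (Finset.sum_le_sum_of_subset ?_)
    intro z
    simp only [Finset.mem_filter, List.mem_cons, List.mem_append]
    tauto

lemma sawCount_cons_cons_le (k : ℕ) (y x : V) (l : List V) :
    sawCount G k (y :: x :: l) ≤ sawCount G k [y, x] :=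
  sawCount_append_le k y [x] l

/-- Submultiplicativity of the number of self-avoiding walks. -/
lemma sawCount_add_le {k K : ℕ} (hK : ∀ x y, G.Adj x y → sawCount G k [y, x] ≤ K) (n : ℕ)
    {x y : V} (hxy : G.Adj x y) (l : List V) :
    sawCount G (n + k) (y :: x :: l) ≤ sawCount G n (y :: x :: l) * K := by
  classical
  induction n generalizing x y l with
  | zero => simpa using (sawCount_cons_cons_le k y x l).trans (hK x y hxy)
  | succ n ih =>
    rw [Nat.add_right_comm, sawCount_succ, sawCount_succ, Finset.sum_mul]
    refine Finset.sum_le_sum fun z hz ↦ ih ?_ _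
    simp only [Finset.mem_filter, SimpleGraph.mem_neighborFinset] at hz
    exact hz.1

lemma sawCount_mul_le {N M : ℕ} (hM : ∀ x y, G.Adj x y → sawCount G N [y, x] ≤ M) (k : ℕ)
    {x y : V} (hxy : G.Adj x y) : sawCount G (k * N) [y, x] ≤ M ^ k := by
  induction k generalizing x y with
  | zero => simp
  | succ k ih =>
    rw [Nat.succ_mul, Nat.add_comm, pow_succ']
    exact (sawCount_add_le (fun _ _ h ↦ ih h) N hxy []).trans (Nat.mul_le_mul_right _ (hM x y hxy))

variable {d : ℕ}

lemma card_neighborFinset_erase [DecidableEq V] (hreg : G.IsRegularOfDegree d) {x y : V}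
    (hxy : G.Adj x y) : ((G.neighborFinset y).erase x).card = d - 1 := by
  rw [Finset.card_erase_of_mem (by simpa using hxy.symm), G.card_neighborFinset_eq_degree,
    hreg y]

lemma sawCount_le_pow (hreg : G.IsRegularOfDegree d) (k : ℕ) {x y : V} (hxy : G.Adj x y)
    (l : List V) : sawCount G k (y :: x :: l) ≤ (d - 1) ^ k := by
  classical
  induction k generalizing x y l with
  | zero => simp
  | succ k ih =>
    rw [sawCount_succ]
    calc _ ≤ ∑ z ∈ (G.neighborFinset y).erase x, (d - 1) ^ k := by
          refine (Finset.sum_le_sum fun z hz ↦ ih (x := y) (y := z) ?_ _).trans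
            (Finset.sum_le_sum_of_subset ?_)
          · simp only [Finset.mem_filter, SimpleGraph.mem_neighborFinset] at hz
            exact hz.1
          · intro z
            simp only [Finset.mem_filter, List.mem_cons, Finset.mem_erase]
            tauto
      _ = _ := by rw [Finset.sum_const, card_neighborFinset_erase hreg hxy, smul_eq_mul, pow_succ']

lemma sawCount_singleton_le (hreg : G.IsRegularOfDegree d) {k K : ℕ}
    (hK : ∀ x y, G.Adj x y → sawCount G k [y, x] ≤ K) (v : V) :
    sawCount G (k + 1) [v] ≤ d * K := by
  classical
  rw [sawCount_succ]
  calc _ ≤ ∑ z ∈ G.neighborFinset v, K := by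
        refine (Finset.sum_le_sum fun z hz ↦ hK v z ?_).trans
          (Finset.sum_le_sum_of_subset (Finset.filter_subset _ _))
        simp only [Finset.mem_filter, SimpleGraph.mem_neighborFinset] at hz
        exact hz.1
    _ = _ := by rw [Finset.sum_const, G.card_neighborFinset_eq_degree, hreg v, smul_eq_mul]

lemma sawCount_map (φ : G ≃g G) (k : ℕ) (l : List V) :
    sawCount G k (l.map φ) = sawCount G k l := by
  classical
  induction k generalizing l with
  | zero => simp
  | succ k ih =>
    cases l with
    | nil => rfl
    | cons y l =>
      rw [List.map_cons, sawCount_succ, sawCount_succ]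
      symm
      refine Finset.sum_bij (fun z _ ↦ φ z) ?_ ?_ ?_ ?_
      · intro z hz
        simpa [φ.map_adj_iff, ← ne_eq, ← List.forall_mem_ne', φ.injective.ne_iff] using hz
      · intro a _ b _ h
        exact φ.injective h
      · intro z hz
        obtain ⟨w, rfl⟩ := φ.surjective z
        refine ⟨w, ?_, rfl⟩
        simpa [φ.map_adj_iff, ← ne_eq, ← List.forall_mem_ne', φ.injective.ne_iff] using hz
      · intro z _
        rw [← ih, List.map_cons, List.map_cons]

end Counting

/-! ### Open self-avoiding walks and the first moment bound. -/

/-- The self-avoiding walk `l` (listed from its last vertex to its first one) can be prolonged by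
`k` steps along open edges, staying self-avoiding. -/
def HasOpenExtension (ω : G.edgeSet → Bool) : ℕ → List V → Prop
  | 0, _ => True
  | _ + 1, [] => False
  | k + 1, y :: l =>
    ∃ z, (openSubgraph G ω).Adj y z ∧ z ∉ y :: l ∧ HasOpenExtension ω k (z :: y :: l)

lemma openSubgraph_adj {ω : G.edgeSet → Bool} {x y : V} :
    (openSubgraph G ω).Adj x y ↔ ∃ h : G.Adj x y, ω ⟨s(x, y), h⟩ = true := by
  simp only [openSubgraph, SimpleGraph.fromEdgeSet_adj, Set.mem_ofPred_eq]
  exact ⟨fun h ↦ ⟨h.1.1, h.1.2⟩, fun h ↦ ⟨⟨h.1, h.2⟩, h.1.ne⟩⟩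

lemma openSubgraph_le (ω : G.edgeSet → Bool) : openSubgraph G ω ≤ G :=
  fun _ _ h ↦ (openSubgraph_adj.1 h).1

lemma not_hasOpenExtension_of_sawCount_eq_zero [G.LocallyFinite] (ω : G.edgeSet → Bool) {k : ℕ}
    {l : List V} (h : sawCount G k l = 0) : ¬ HasOpenExtension ω k l := by
  induction k generalizing l with
  | zero => simp at h
  | succ k ih =>
    cases l with
    | nil => exact id
    | cons y l =>
      rintro ⟨z, hz, hzl, he⟩
      rw [sawCount_succ, Finset.sum_eq_zero_iff] at h
      refine ih (h z ?_) he
      simpa using And.intro (openSubgraph_le ω hz) (by simpa using hzl)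

lemma hasOpenExtension_of_isPath (ω : G.edgeSet → Bool) {y z : V}
    (p : (openSubgraph G ω).Walk y z) (hp : p.IsPath) (l : List V)
    (hl : ∀ v ∈ p.support, v ∉ l) : HasOpenExtension ω p.length (y :: l) := by
  induction p generalizing l with
  | nil => trivial
  | @cons a b c h p ih =>
    rw [SimpleGraph.Walk.cons_isPath_iff] at hp
    refine ⟨b, h, ?_, ih hp.1 _ fun v hv ↦ ?_⟩
    · rw [List.mem_cons, not_or]
      exact ⟨h.ne', hl b (by simp)⟩
    · rw [List.mem_cons, not_or]
      exact ⟨fun e ↦ hp.2 (e ▸ hv), hl v (by simp [hv])⟩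

lemma finite_setOf_exists_walk_length_le [G.LocallyFinite] {H : SimpleGraph V} (hH : H ≤ G)
    (k : ℕ) (v : V) : {w | ∃ p : H.Walk v w, p.length ≤ k}.Finite := by
  induction k generalizing v with
  | zero =>
    refine (Set.finite_singleton v).subset ?_
    rintro w ⟨p, hp⟩
    exact (SimpleGraph.Walk.eq_of_length_eq_zero (Nat.le_zero.1 hp)).symm
  | succ k ih =>
    refine ((Set.finite_singleton v).union
      ((G.neighborFinset v).finite_toSet.biUnion fun u _ ↦ ih u)).subset ?_
    rintro w ⟨p, hp⟩
    cases p with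
    | nil => exact Or.inl rfl
    | @cons _ b _ h p =>
      refine Or.inr (Set.mem_biUnion (x := b) ?_ ⟨p, ?_⟩)
      · simpa using hH h
      · simpa using hp

/-- Balls are finite, so the cluster has a vertex beyond distance `k`; an open path to it is cut
after `k` steps. -/
lemma hasOpenExtension_of_infinite [G.LocallyFinite] {ω : G.edgeSet → Bool}
    {C : (openSubgraph G ω).ConnectedComponent} (hC : C.supp.Infinite) {v : V} (hv : v ∈ C.supp)
    (k : ℕ) : HasOpenExtension ω k [v] := by
  classical
  obtain ⟨w, hw, hwk⟩ :=
    hC.exists_notMem_finite (finite_setOf_exists_walk_length_le (openSubgraph_le ω) k v)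
  obtain ⟨q⟩ : (openSubgraph G ω).Reachable v w :=
    SimpleGraph.ConnectedComponent.exact (hv.trans hw.symm)
  have hp := q.bypass_isPath
  have hk : k ≤ q.bypass.length := by
    by_contra! h
    exact hwk ⟨q.bypass, h.le⟩
  have := hasOpenExtension_of_isPath ω (q.bypass.take k) (hp.take k) [] (by simp)
  rwa [SimpleGraph.Walk.take_length, min_eq_left hk] at this

lemma countable_of_connected [G.LocallyFinite] (hconn : G.Connected) : Countable V := by
  obtain ⟨v⟩ := hconn.nonempty
  rw [← Set.countable_univ_iff]
  refine (Set.countable_iUnion fun k ↦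
    (finite_setOf_exists_walk_length_le (le_refl G) k v).countable).mono (s₁ := Set.univ) ?_
  intro w _
  obtain ⟨p⟩ := hconn.preconnected v w
  exact Set.mem_iUnion.2 ⟨p.length, p, le_rfl⟩

instance isProbabilityMeasure_percMeasure (p : I) : IsProbabilityMeasure (percMeasure G p) := by
  unfold percMeasure; infer_instance

lemma percMeasure_forall_open (p : I) (S : Finset G.edgeSet) :
    percMeasure G p {ω | ∀ e ∈ S, ω e = true} = ENNReal.ofReal p ^ S.card := by
  have : {ω : G.edgeSet → Bool | ∀ e ∈ S, ω e = true} =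
      Set.pi (S : Set G.edgeSet) (fun _ ↦ {true}) := by
    ext; simp
  rw [this, percMeasure, Measure.infinitePi_pi _ (fun _ _ ↦ MeasurableSet.singleton _)]
  rw [Finset.prod_congr rfl (g := fun _ ↦ ENNReal.ofReal p), Finset.prod_const]
  intro e _
  rw [bernoulliMeasure_apply_of_mem_of_notMem p (MeasurableSet.singleton _) rfl (by simp)]
  rw [ENNReal.ofReal]
  congr 1
  ext
  simp [p.2.1]

/-- A union bound over the next step. `S` collects the edges already required open; a new edge has
an end outside `l`, so it is not in `S` and brings a fresh factor `p`. -/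
lemma percMeasure_hasOpenExtension_le [G.LocallyFinite] (p : I) (k : ℕ) (l : List V)
    (S : Finset G.edgeSet) (hS : ∀ e ∈ S, ∀ v ∈ e.1, v ∈ l) :
    percMeasure G p {ω | (∀ e ∈ S, ω e = true) ∧ HasOpenExtension ω k l} ≤
      ENNReal.ofReal p ^ (S.card + k) * sawCount G k l := by
  classical
  induction k generalizing l S with
  | zero =>
    simpa [HasOpenExtension] using (percMeasure_forall_open p S).le
  | succ k ih =>
    cases l with
    | nil => simp [HasOpenExtension]
    | cons y l =>
      rw [sawCount_succ, Nat.cast_sum, Finset.mul_sum]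
      set T := {z ∈ G.neighborFinset y | z ∉ y :: l}
      let S' : V → Finset G.edgeSet := fun z ↦
        if h : G.Adj y z then insert ⟨s(y, z), h⟩ S else S
      calc _ ≤ percMeasure G p (⋃ z ∈ T,
              {ω | (∀ e ∈ S' z, ω e = true) ∧ HasOpenExtension ω k (z :: y :: l)}) := by
            refine measure_mono ?_
            rintro ω ⟨h1, z, hz, hzl, he⟩
            obtain ⟨ha, ho⟩ := openSubgraph_adj.1 hz
            refine Set.mem_biUnion (x := z) ?_ ⟨?_, he⟩
            · simpa [T, ha] using hzl
            · simpa [S', ha, ho] using h1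
        _ ≤ ∑ z ∈ T, percMeasure G p
              {ω | (∀ e ∈ S' z, ω e = true) ∧ HasOpenExtension ω k (z :: y :: l)} :=
            measure_biUnion_finset_le _ _
        _ ≤ _ := by
            refine Finset.sum_le_sum fun z hz ↦ ?_
            simp only [T, Finset.mem_filter, SimpleGraph.mem_neighborFinset] at hz
            have hS' : S' z = insert ⟨s(y, z), hz.1⟩ S := by simp [S', hz.1]
            have hcard : (S' z).card = S.card + 1 := by
              rw [hS', Finset.card_insert_of_notMem]
              intro hmem
              exact hz.2 (hS _ hmem z (by simp))
            have := ih (z :: y :: l) (S' z) (by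
              rw [hS']
              intro e he v hv
              rcases Finset.mem_insert.1 he with rfl | he
              · simp only [Sym2.mem_iff] at hv
                rcases hv with rfl | rfl <;> simp
              · exact List.mem_cons_of_mem _ (hS e he v hv))
            rwa [hcard, Nat.add_right_comm] at this

/-- If the expected number of open self-avoiding walks with `k` steps from each vertex is arbitrarily
small for suitable `k`, then there is almost surely no infinite cluster. -/
lemma percProb_eq_zero [G.LocallyFinite] (hconn : G.Connected) (p : I)
    (h : ∀ v : V, ∀ ε > 0, ∃ k, (p : ℝ) ^ k * sawCount G k [v] < ε) : percProb G p = 0 := by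
  have := countable_of_connected hconn
  rw [percProb, measureReal_def, ENNReal.toReal_eq_zero_iff]
  left
  -- Monotonicity holds for arbitrary sets, so measurability of these events is not needed.
  refine measure_mono_null (t := ⋃ v : V, {ω | ∀ k, HasOpenExtension ω k [v]}) ?_ ?_
  · rintro ω ⟨C, hC⟩
    obtain ⟨v, hv⟩ := hC.nonempty
    exact Set.mem_iUnion.2 ⟨v, fun k ↦ hasOpenExtension_of_infinite (G := G) hC hv k⟩
  · refine measure_iUnion_null fun v ↦ ?_
    by_contra hne
    have hpos := ENNReal.toReal_pos hne (measure_ne_top _ _)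
    obtain ⟨k, hk⟩ := h v _ hpos
    have h1 := percMeasure_hasOpenExtension_le (G := G) p k [v] ∅ (by simp)
    have h2 : percMeasure G p {ω | ∀ k, HasOpenExtension ω k [v]} ≤
        ENNReal.ofReal p ^ k * sawCount G k [v] := by
      refine (measure_mono fun ω hω ↦ ?_).trans (by simpa using h1)
      exact hω k
    have h3 := ENNReal.toReal_mono (by finiteness) h2
    rw [ENNReal.toReal_mul, ENNReal.toReal_pow, ENNReal.toReal_ofReal p.2.1,
      ENNReal.toReal_natCast] at h3
    exact absurd h3 (not_le.2 hk)

/-! ### Uniform loss of self-avoiding walks on graphs with cycles. -/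

section GraphsWithCycles

/-- A family of upper bounds that is invariant under automorphisms is uniform on a
quasi-transitive graph. -/
lemma exists_forall_of_isQuasiTransitive (hqt : G.IsQuasiTransitive) {P : V → ℕ → Prop}
    (hmono : ∀ v m n, m ≤ n → P v m → P v n)
    (hinv : ∀ (φ : G ≃g G) v n, P v n → P (φ v) n) (h : ∀ v, ∃ n, P v n) :
    ∃ n, ∀ v, P v n := by
  have : Finite (MulAction.orbitRel.Quotient (G ≃g G) V) := hqt
  choose f hf using h
  obtain ⟨N, hN⟩ := (Set.finite_range
    fun q : MulAction.orbitRel.Quotient (G ≃g G) V ↦ f (Quotient.out q)).bddAbove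
  refine ⟨N, fun v ↦ ?_⟩
  let q : MulAction.orbitRel.Quotient (G ≃g G) V := Quotient.mk'' v
  have hq : MulAction.orbitRel (G ≃g G) V v (Quotient.out q) :=
    Quotient.exact (Quotient.out_eq q).symm
  obtain ⟨φ, hφ⟩ := hq
  have hφ' : φ (Quotient.out q) = v := hφ
  rw [← hφ']
  exact hinv φ _ _ (hmono _ _ _ (hN ⟨q, rfl⟩) (hf _))

variable [G.LocallyFinite] {d : ℕ}

/-- Every non-backtracking prolongation of the walk `l` is self-avoiding, as witnessed by the
number of self-avoiding prolongations in a `d`-regular graph. -/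
def IsFree (G : SimpleGraph V) [G.LocallyFinite] (d : ℕ) (l : List V) : Prop :=
  ∀ k, sawCount G k l = (d - 1) ^ k

/-- The count is a sum over `d - 1` neighbours of terms at most `(d - 1) ^ k`; being maximal, it
forces each term to be maximal. -/
lemma IsFree.cons (hreg : G.IsRegularOfDegree d) (hd : 2 ≤ d) {x y z : V} {l : List V}
    (hxy : G.Adj x y) (h : IsFree G d (y :: x :: l)) (hyz : G.Adj y z) (hzx : z ≠ x) :
    z ∉ y :: x :: l ∧ IsFree G d (z :: y :: x :: l) := by
  classical
  have hpos : ∀ k, 0 < (d - 1) ^ k := fun k ↦ pow_pos (by omega) k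
  have key : ∀ k, (if z ∉ y :: x :: l then sawCount G k (z :: y :: x :: l) else 0) =
      (d - 1) ^ k := by
    intro k
    have hle : ∀ w ∈ (G.neighborFinset y).erase x,
        (if w ∉ y :: x :: l then sawCount G k (w :: y :: x :: l) else 0) ≤ (d - 1) ^ k := by
      intro w hw
      have hw' : G.Adj y w := by simpa using Finset.mem_of_mem_erase hw
      split_ifs
      · exact Nat.zero_le _
      · exact sawCount_le_pow hreg k hw' _
    refine (Finset.sum_eq_sum_iff_of_le hle).1 ?_ z (by simp [hyz, hzx])
    rw [Finset.sum_const, card_neighborFinset_erase hreg hxy, smul_eq_mul, ← pow_succ',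
      ← h (k + 1), sawCount_succ, ← Finset.sum_filter]
    refine Finset.sum_congr ?_ fun _ _ ↦ rfl
    ext w
    simp only [Finset.mem_filter, List.mem_cons, Finset.mem_erase]
    tauto
  have hz : z ∉ y :: x :: l := by
    by_contra hz
    have := key 0
    rw [if_neg (not_not.2 hz)] at this
    exact (hpos 0).ne this
  exact ⟨hz, fun k ↦ by have := key k; rwa [if_pos hz] at this⟩

lemma IsFree.notMem_of_isPath (hreg : G.IsRegularOfDegree d) (hd : 2 ≤ d) {z w : V}
    (p : G.Walk z w) (hp : p.IsPath) {x y : V} {l : List V}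
    (hxy : G.Adj x y) (h : IsFree G d (y :: x :: l)) (hyz : G.Adj y z) (hzx : z ≠ x)
    (hpe : s(y, z) ∉ p.edges) : w ∉ y :: x :: l := by
  induction p generalizing x y l with
  | nil => exact (h.cons hreg hd hxy hyz hzx).1
  | @cons a b c hab p ih =>
    rw [SimpleGraph.Walk.cons_isPath_iff] at hp
    simp only [SimpleGraph.Walk.edges_cons, List.mem_cons, not_or] at hpe
    have := ih hp.1 hyz (h.cons hreg hd hxy hyz hzx).2 hab
      (fun e ↦ hpe.1 (by rw [e, Sym2.eq_swap]))
      (fun e ↦ hp.2 (p.fst_mem_support_of_mem_edges e))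
    exact fun hc ↦ this (List.mem_cons_of_mem _ hc)

/-- A cycle at `y` not starting towards `x` would be a non-backtracking return to `y`. So the cycle
and its reverse both start towards `x`, which no cycle does. -/
lemma IsFree.not_isCycle (hreg : G.IsRegularOfDegree d) (hd : 2 ≤ d) {x y : V} {l : List V}
    (hxy : G.Adj x y) (h : IsFree G d (y :: x :: l)) (c : G.Walk y y) : ¬ c.IsCycle := by
  have key : ∀ c : G.Walk y y, c.IsCycle → c.snd = x := by
    intro c hc
    cases c with
    | nil => exact absurd hc (by simp)
    | cons hyz p =>
      rw [SimpleGraph.Walk.cons_isCycle_iff] at hc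
      by_contra hne
      exact h.notMem_of_isPath hreg hd p hc.1 hxy hyz (by simpa using hne) hc.2 (by simp)
  intro hc
  apply hc.snd_ne_penultimate
  rw [key c hc, ← key c.reverse hc.reverse, SimpleGraph.Walk.snd_reverse]

/-- The oriented edge `x → y` can be reached by a non-backtracking walk with `k` steps, all of
whose non-backtracking prolongations, at any stage, are self-avoiding. -/
def FreeAtDepth (G : SimpleGraph V) [G.LocallyFinite] (d : ℕ) : ℕ → V → V → Prop
  | 0, x, y => G.Adj x y ∧ ∃ l, IsFree G d (y :: x :: l)
  | k + 1, x, y => (G.Adj x y ∧ ∃ l, IsFree G d (y :: x :: l)) ∧ ∃ w, FreeAtDepth G d k w x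

lemma FreeAtDepth.adj_and_isFree {k : ℕ} {x y : V} (h : FreeAtDepth G d k x y) :
    G.Adj x y ∧ ∃ l, IsFree G d (y :: x :: l) := by
  cases k with
  | zero => exact h
  | succ k => exact h.1

lemma FreeAtDepth.of_succ {k : ℕ} {x y : V} (h : FreeAtDepth G d (k + 1) x y) :
    FreeAtDepth G d k x y := by
  induction k generalizing x y with
  | zero => exact h.1
  | succ k ih =>
    obtain ⟨h1, w, hw⟩ := h
    exact ⟨h1, w, ih hw⟩

lemma FreeAtDepth.succ (hreg : G.IsRegularOfDegree d) (hd : 2 ≤ d) {k : ℕ} {x y z : V}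
    (h : FreeAtDepth G d k x y) (hyz : G.Adj y z) (hzx : z ≠ x) :
    FreeAtDepth G d (k + 1) y z := by
  obtain ⟨hxy, l, hl⟩ := h.adj_and_isFree
  exact ⟨⟨hyz, _, (hl.cons hreg hd hxy hyz hzx).2⟩, x, h⟩

/-- A step back to `x` uses up one level of the recorded history; any other step prolongs the free
walk. -/
lemma FreeAtDepth.exists_of_adj (hreg : G.IsRegularOfDegree d) (hd : 2 ≤ d) {k : ℕ} {x y z : V}
    (h : FreeAtDepth G d (k + 1) x y) (hyz : G.Adj y z) : ∃ w, FreeAtDepth G d k w z := by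
  by_cases hzx : z = x
  · subst hzx; exact h.2
  · exact ⟨y, (h.succ hreg hd hyz hzx).of_succ.of_succ⟩

lemma FreeAtDepth.exists_of_walk (hreg : G.IsRegularOfDegree d) (hd : 2 ≤ d) {y z : V}
    (p : G.Walk y z) {k : ℕ} {x : V} (h : FreeAtDepth G d k x y) (hk : p.length ≤ k) :
    ∃ w, FreeAtDepth G d 0 w z := by
  induction p generalizing k x with
  | nil => exact ⟨x, h.adj_and_isFree⟩
  | cons hab p ih =>
    cases k with
    | zero => simp at hk
    | succ k =>
      obtain ⟨w, hw⟩ := h.exists_of_adj hreg hd hab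
      exact ih hw (by simpa using hk)

lemma exists_freeAtDepth (hreg : G.IsRegularOfDegree d) (hd : 2 ≤ d) {x y : V}
    (hxy : G.Adj x y) (h : IsFree G d [y, x]) (k : ℕ) : ∃ a b, FreeAtDepth G d k a b := by
  classical
  induction k with
  | zero => exact ⟨x, y, hxy, [], h⟩
  | succ k ih =>
    obtain ⟨a, b, hab⟩ := ih
    have hcard := card_neighborFinset_erase hreg hab.adj_and_isFree.1
    obtain ⟨z, hz⟩ := Finset.card_pos.1 (hcard ▸ (by omega : 0 < d - 1))
    simp only [Finset.mem_erase, SimpleGraph.mem_neighborFinset] at hz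
    exact ⟨b, z, hab.succ hreg hd hz.2 hz.1⟩

/-- On a regular quasi-transitive graph that contains a cycle, the number of non-backtracking
prolongations of any oriented edge exceeds the number of self-avoiding ones. -/
lemma not_isFree (hconn : G.Connected) (hqt : G.IsQuasiTransitive)
    (hreg : G.IsRegularOfDegree d) (hd : 2 ≤ d) (hG : ¬ G.IsTree) {x y : V} (hxy : G.Adj x y) :
    ¬ IsFree G d [y, x] := by
  intro h
  obtain ⟨v, c, hc⟩ : ∃ (v : V) (c : G.Walk v v), c.IsCycle := by
    by_contra! hcon
    exact hG ⟨hconn, fun v c ↦ hcon v c⟩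
  obtain ⟨R, hR⟩ := exists_forall_of_isQuasiTransitive hqt
    (P := fun u n ↦ ∃ (w : V) (p : G.Walk u w) (c : G.Walk w w), p.length ≤ n ∧ c.IsCycle)
    (fun _ _ _ hmn ⟨w, p, c, hp, hc⟩ ↦ ⟨w, p, c, hp.trans hmn, hc⟩)
    (fun φ u n ⟨w, p, c, hp, hc⟩ ↦ ⟨φ w, p.map φ.toHom, c.map φ.toHom, by simpa using hp,
      hc.map φ.injective⟩)
    (fun u ↦ by
      obtain ⟨p⟩ := hconn.preconnected u v
      exact ⟨p.length, v, p, c, le_rfl, hc⟩)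
  -- Depth `R` suffices to follow any walk of length at most `R` from `b`, in particular one to a
  -- cycle.
  obtain ⟨a, b, hab⟩ := exists_freeAtDepth hreg hd hxy h R
  obtain ⟨w, p, c, hp, hc⟩ := hR b
  obtain ⟨w', hw'w, l, hl⟩ := hab.exists_of_walk hreg hd p hp
  exact hl.not_isCycle hreg hd hw'w c hc

lemma exists_sawCount_lt (hconn : G.Connected) (hqt : G.IsQuasiTransitive)
    (hreg : G.IsRegularOfDegree d) (hd : 2 ≤ d) (hG : ¬ G.IsTree) :
    ∃ N, ∀ x y, G.Adj x y → sawCount G N [y, x] < (d - 1) ^ N := by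
  have hpos : ∀ k, 0 < (d - 1) ^ k := fun k ↦ pow_pos (by omega) k
  have hmono : ∀ x y, G.Adj x y → ∀ m n, m ≤ n → sawCount G m [y, x] < (d - 1) ^ m →
      sawCount G n [y, x] < (d - 1) ^ n := by
    intro x y hxy m n hmn h
    obtain ⟨k, rfl⟩ := Nat.exists_eq_add_of_le hmn
    refine (sawCount_add_le (fun _ _ h ↦ sawCount_le_pow hreg k h []) m hxy []).trans_lt ?_
    rw [pow_add]
    exact Nat.mul_lt_mul_of_pos_right h (hpos k)
  obtain ⟨N, hN⟩ := exists_forall_of_isQuasiTransitive hqt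
    (P := fun x n ↦ ∀ y, G.Adj x y → sawCount G n [y, x] < (d - 1) ^ n)
    (fun x m n hmn h y hxy ↦ hmono x y hxy m n hmn (h y hxy))
    (fun φ x n h y hxy ↦ by
      obtain ⟨y, rfl⟩ := φ.surjective y
      have := sawCount_map φ n [y, x]
      rw [List.map_cons, List.map_cons, List.map_nil] at this
      rw [this]
      exact h y (φ.map_adj_iff.1 hxy))
    (fun x ↦ by
      have : ∀ y, G.Adj x y → ∃ n, sawCount G n [y, x] < (d - 1) ^ n := by
        intro y hxy
        have := not_isFree hconn hqt hreg hd hG hxy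
        rw [IsFree, not_forall] at this
        obtain ⟨n, hn⟩ := this
        exact ⟨n, lt_of_le_of_ne (sawCount_le_pow hreg n hxy []) hn⟩
      choose! f hf using this
      refine ⟨(G.neighborFinset x).sup f, fun y hxy ↦ hmono x y hxy _ _ ?_ (hf y hxy)⟩
      exact Finset.le_sup (by simpa using hxy))
  exact ⟨N, hN⟩

/-- With every edge open, `G` itself is an infinite cluster. -/
lemma sawCount_singleton_pos [Infinite V] (hconn : G.Connected) (k : ℕ) (v : V) :
    0 < sawCount G k [v] := by
  classical
  rw [Nat.pos_iff_ne_zero]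
  intro h
  have htop : openSubgraph G (fun _ ↦ true) = G := by
    ext x y
    rw [openSubgraph_adj]
    simp
  have hpre : (openSubgraph G (fun _ ↦ true)).Preconnected := by
    rw [htop]
    exact hconn.preconnected
  refine not_hasOpenExtension_of_sawCount_eq_zero (fun _ ↦ true) h (hasOpenExtension_of_infinite
    (C := (openSubgraph G (fun _ ↦ true)).connectedComponentMk v) ?_ rfl k)
  convert Set.infinite_univ (α := V)
  ext w
  simpa using hpre w v

end GraphsWithCycles

/-! ### Lower bounds for the threshold. -/

section LowerBound

variable {d : ℕ}

lemma le_criticalThreshold {p : ℝ} (hp : p ∈ I) (h : percProb G ⟨p, hp⟩ = 0) :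
    p ≤ criticalThreshold G :=
  le_csSup ⟨1, fun _ hx ↦ hx.1.2⟩ ⟨hp, h⟩

variable [G.LocallyFinite]

lemma two_le_of_isRegularOfDegree [Infinite V] (hconn : G.Connected)
    (hreg : G.IsRegularOfDegree d) : 2 ≤ d := by
  obtain ⟨v⟩ := hconn.nonempty
  have h := (sawCount_singleton_pos hconn 2 v).trans_le
    (sawCount_singleton_le hreg (k := 1) (fun x y hxy ↦ sawCount_le_pow hreg 1 hxy []) v)
  by_contra! hd
  interval_cases d <;> simp at h

lemma percProb_eq_zero_of_sawCount_le (hconn : G.Connected) (hreg : G.IsRegularOfDegree d)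
    {N M : ℕ} (hM : ∀ x y, G.Adj x y → sawCount G N [y, x] ≤ M) (p : I)
    (hp : (p : ℝ) ^ N * M < 1) : percProb G p = 0 := by
  refine percProb_eq_zero hconn p fun v ε hε ↦ ?_
  have hlim := (tendsto_pow_atTop_nhds_zero_of_lt_one (r := (p : ℝ) ^ N * M)
    (mul_nonneg (pow_nonneg p.2.1 _) (Nat.cast_nonneg _)) hp).const_mul (p * d : ℝ)
  rw [mul_zero] at hlim
  obtain ⟨j, hj⟩ := (hlim.eventually_lt_const hε).exists
  -- The extra step chooses the first oriented edge and costs the factor `p * d`.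
  refine ⟨j * N + 1, lt_of_le_of_lt ?_ hj⟩
  have h : (sawCount G (j * N + 1) [v] : ℝ) ≤ d * M ^ j := by
    exact_mod_cast sawCount_singleton_le hreg (fun x y hxy ↦ sawCount_mul_le hM j hxy) v
  calc (p : ℝ) ^ (j * N + 1) * sawCount G (j * N + 1) [v]
      ≤ (p : ℝ) ^ (j * N + 1) * (d * M ^ j) :=
        mul_le_mul_of_nonneg_left h (pow_nonneg p.2.1 _)
    _ = p * d * ((p : ℝ) ^ N * M) ^ j := by
        rw [mul_pow, ← pow_mul, mul_comm N j, pow_succ]; ring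

lemma one_div_le_criticalThreshold (hconn : G.Connected) (hreg : G.IsRegularOfDegree d)
    (hd : 2 ≤ d) : 1 / ((d : ℝ) - 1) ≤ criticalThreshold G := by
  have hd' : (1 : ℝ) ≤ d - 1 := by
    have : (2 : ℝ) ≤ d := by exact_mod_cast hd
    linarith
  have key : ∀ q : ℝ, 0 ≤ q → q < 1 / ((d : ℝ) - 1) → q ≤ criticalThreshold G := by
    intro q hq0 hq
    have hq1 : q * (d - 1) < 1 := by rwa [lt_div_iff₀ (by linarith)] at hq
    refine le_criticalThreshold ⟨hq0, by nlinarith⟩ ?_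
    refine percProb_eq_zero_of_sawCount_le hconn hreg (N := 1)
      (fun x y hxy ↦ sawCount_le_pow hreg 1 hxy []) _ ?_
    simpa [Nat.cast_sub (show 1 ≤ d by omega)] using hq1
  refine le_of_forall_lt_imp_le_of_dense fun q hq ↦ ?_
  rcases le_total 0 q with h0 | h0
  · exact key q h0 hq
  · exact h0.trans (key 0 le_rfl (by positivity))

lemma one_div_lt_criticalThreshold [Infinite V] (hconn : G.Connected)
    (hqt : G.IsQuasiTransitive) (hreg : G.IsRegularOfDegree d) (hG : ¬ G.IsTree) :
    1 / ((d : ℝ) - 1) < criticalThreshold G := by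
  have hd := two_le_of_isRegularOfDegree hconn hreg
  obtain ⟨N, hN⟩ := exists_sawCount_lt hconn hqt hreg hd hG
  have hM : ∀ x y, G.Adj x y → sawCount G N [y, x] ≤ (d - 1) ^ N - 1 :=
    fun x y hxy ↦ Nat.le_sub_one_of_lt (hN x y hxy)
  -- For `d = 2` the bound `(d - 1) ^ N - 1` is 0, contradicting the existence of long walks. With
  -- `d ≥ 3` there is room between `1 / (d - 1)` and 1.
  have hd3 : 3 ≤ d := by
    by_contra! h
    obtain rfl : d = 2 := by omega
    obtain ⟨v⟩ := hconn.nonempty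
    have := (sawCount_singleton_pos hconn (N + 1) v).trans_le (sawCount_singleton_le hreg hM v)
    simp at this
  have hd' : (2 : ℝ) ≤ d - 1 := by
    have : (3 : ℝ) ≤ d := by exact_mod_cast hd3
    linarith
  have hq1 : 1 / ((d : ℝ) - 1) < 1 := by
    rw [div_lt_one (by linarith)]; linarith
  have hcast : (((d - 1) ^ N - 1 : ℕ) : ℝ) = ((d : ℝ) - 1) ^ N - 1 := by
    rw [Nat.cast_sub (Nat.one_le_pow _ _ (by omega)), Nat.cast_pow,
      Nat.cast_sub (by omega), Nat.cast_one]
  have hlt : (1 / ((d : ℝ) - 1)) ^ N * (((d - 1) ^ N - 1 : ℕ) : ℝ) < 1 := by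
    rw [hcast, mul_sub, ← mul_pow, one_div_mul_cancel (by linarith), one_pow, mul_one]
    have : 0 < (1 / ((d : ℝ) - 1)) ^ N := by positivity
    linarith
  have hcont : Continuous fun q : ℝ ↦ q ^ N * (((d - 1) ^ N - 1 : ℕ) : ℝ) := by fun_prop
  have hev := (hcont.tendsto (1 / ((d : ℝ) - 1))).eventually_lt_const hlt
  obtain ⟨q, hq, hqI⟩ := ((hev.filter_mono nhdsWithin_le_nhds).and
    (Ioo_mem_nhdsGT hq1)).exists
  have hq0 : 0 ≤ q := le_trans (by positivity) hqI.1.le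
  exact hqI.1.trans_le (le_criticalThreshold ⟨hq0, hqI.2.le⟩
    (percProb_eq_zero_of_sawCount_le hconn hreg hM _ hq))

end LowerBound

/-! ### Branches of a tree. -/

section Tree

/-- The neighbour of `y` closer to `w` must be the penultimate vertex of the unique path from `w` to
`y`. -/
lemma eq_of_dist_eq_dist_add_one (hG : G.IsTree) {y z z' w : V} (hz : G.Adj y z)
    (hz' : G.Adj y z') (h : G.dist w y = G.dist w z + 1) (h' : G.dist w y = G.dist w z' + 1) :
    z = z' := by
  classical
  obtain ⟨p, hp, -⟩ := hG.existsUnique_path w y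
  have key : ∀ u, G.Adj y u → G.dist w y = G.dist w u + 1 → u = p.penultimate := by
    intro u hu hd
    obtain ⟨q, hq, hql⟩ := (hG.connected w u).exists_path_of_dist
    refine hG.isAcyclic.eq_penultimate_of_adj_end hp hu
      (hG.isAcyclic.mem_support_of_ne_mem_support_of_adj_of_isPath hp hq hu fun hy ↦ ?_)
    have h1 := SimpleGraph.dist_le (q.takeUntil y hy)
    have h2 := q.length_takeUntil_le_length hy
    omega
  rw [key z hz h, key z' hz' h']

/-- In a tree with an edge `x y`, the vertices separated from `x` by that edge. -/
def branch (G : SimpleGraph V) (x y : V) : Set V := {w | G.dist w x = G.dist w y + 1}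

/-- The edges of the branch of `y` seen from `x`. -/
def branchEdges (G : SimpleGraph V) (x y : V) : Set G.edgeSet :=
  {e | ∀ v ∈ e.1, v ∈ branch G x y}

lemma self_mem_branch {x y : V} (hxy : G.Adj x y) : y ∈ branch G x y := by
  simpa [branch, SimpleGraph.dist_eq_one_iff_adj] using hxy.symm

lemma notMem_branch (x y : V) : x ∉ branch G x y := by
  simp [branch]

lemma branch_subset (hG : G.IsTree) {x y z : V} (hxy : G.Adj x y) (hyz : G.Adj y z)
    (hzx : z ≠ x) : branch G y z ⊆ branch G x y := by
  intro w hw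
  rcases hG.dist_eq_dist_add_one_of_adj w hxy with h | h
  · exact h
  · exact absurd (eq_of_dist_eq_dist_add_one hG hyz hxy.symm hw h) hzx

/-- The edges of the branch of `y` seen from `x`, together with the edge `x y` itself. -/
def plantedEdges (G : SimpleGraph V) (x y : V) : Set G.edgeSet :=
  {e | e.1 = s(x, y)} ∪ branchEdges G x y

lemma disjoint_plantedEdges (hG : G.IsTree) {y z z' : V} (hz : G.Adj y z) (hz' : G.Adj y z')
    (hne : z ≠ z') : Disjoint (plantedEdges G y z) (plantedEdges G y z') := by
  rw [Set.disjoint_left]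
  rintro ⟨e, he⟩ (h | h) (h' | h')
  · exact hne (Sym2.congr_right.1 (h.symm.trans h'))
  · have h : e = s(y, z) := h
    exact notMem_branch y z' (h' y (by simp [h]))
  · have h' : e = s(y, z') := h'
    exact notMem_branch y z (h y (by simp [h']))
  · induction e with
    | _ a b =>
      exact hne (eq_of_dist_eq_dist_add_one hG hz hz' (h a (by simp)) (h' a (by simp)))

lemma plantedEdges_subset (hG : G.IsTree) {x y z : V} (hxy : G.Adj x y) (hyz : G.Adj y z)
    (hzx : z ≠ x) : plantedEdges G y z ⊆ branchEdges G x y := by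
  rintro ⟨e, he⟩ (h | h) v hv
  · have h : e = s(y, z) := h
    subst h
    rcases Sym2.mem_iff.1 hv with rfl | rfl
    · exact self_mem_branch hxy
    · exact branch_subset hG hxy hyz hzx (self_mem_branch hyz)
  · exact branch_subset hG hxy hyz hzx (h v hv)

end Tree

/-! ### Independence over disjoint edge sets. -/

section Independence

/-- The σ-algebra generated by the states of the edges in `S`. -/
@[reducible]
def edgeSigma (S : Set G.edgeSet) : MeasurableSpace (G.edgeSet → Bool) :=
  ⨆ e ∈ S, MeasurableSpace.comap (fun ω : G.edgeSet → Bool ↦ ω e) inferInstance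

lemma edgeSigma_mono {S T : Set G.edgeSet} (h : S ⊆ T) : edgeSigma S ≤ edgeSigma T :=
  biSup_mono h

lemma edgeSigma_le (S : Set G.edgeSet) : edgeSigma S ≤ MeasurableSpace.pi :=
  iSup₂_le fun e _ ↦ (measurable_pi_apply e).comap_le

lemma measure_inter_of_disjoint (p : I) {S T : Set G.edgeSet} (hST : Disjoint S T)
    {A B : Set (G.edgeSet → Bool)} (hA : MeasurableSet[edgeSigma S] A)
    (hB : MeasurableSet[edgeSigma T] B) :
    (percMeasure G p).real (A ∩ B) = (percMeasure G p).real A * (percMeasure G p).real B := by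
  have hind : iIndepFun (fun (e : G.edgeSet) (ω : G.edgeSet → Bool) ↦ ω e) (percMeasure G p) :=
    iIndepFun_infinitePi (X := fun _ ↦ id) (fun _ ↦ measurable_id)
  have := (indep_iSup_of_disjoint (fun e ↦ (measurable_pi_apply e).comap_le) hind hST)
  rw [measureReal_def, (Indep_iff _ _ _).1 this A B hA hB, ENNReal.toReal_mul]
  rfl

lemma measure_biInter_of_pairwise_disjoint {ι : Type*} [DecidableEq ι] (p : I) (F : Finset ι)
    {S : ι → Set G.edgeSet} (hS : ∀ i ∈ F, ∀ j ∈ F, i ≠ j → Disjoint (S i) (S j))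
    {A : ι → Set (G.edgeSet → Bool)} (hA : ∀ i ∈ F, MeasurableSet[edgeSigma (S i)] (A i)) :
    (percMeasure G p).real (⋂ i ∈ F, A i) = ∏ i ∈ F, (percMeasure G p).real (A i) := by
  induction F using Finset.induction_on with
  | empty => simp
  | insert a F ha ih =>
    rw [Finset.set_biInter_insert, Finset.prod_insert ha, ← ih
      (fun i hi j hj ↦ hS i (Finset.mem_insert_of_mem hi) j (Finset.mem_insert_of_mem hj))
      (fun i hi ↦ hA i (Finset.mem_insert_of_mem hi))]
    refine measure_inter_of_disjoint p (S := S a) (T := ⋃ i ∈ F, S i) ?_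
      (hA a (Finset.mem_insert_self _ _)) ?_
    · rw [Set.disjoint_iUnion₂_right]
      intro i hi
      exact hS a (Finset.mem_insert_self _ _) i (Finset.mem_insert_of_mem hi)
        fun e ↦ ha (e ▸ hi)
    · refine @Finset.measurableSet_biInter _ _ (edgeSigma (⋃ i ∈ F, S i)) _ F fun i hi ↦ ?_
      exact edgeSigma_mono (Set.subset_biUnion_of_mem (u := S) (show i ∈ (F : Set ι) from hi)) _
        (hA i (Finset.mem_insert_of_mem hi))

lemma measurableSet_edgeSigma_open {S : Set G.edgeSet} {e : G.edgeSet} (he : e ∈ S) :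
    MeasurableSet[edgeSigma S] {ω | ω e = true} := by
  refine le_iSup₂ (f := fun (e : G.edgeSet) (_ : e ∈ S) ↦
    MeasurableSpace.comap (fun ω : G.edgeSet → Bool ↦ ω e) inferInstance) e he _ ?_
  exact ⟨{true}, MeasurableSet.singleton _, rfl⟩

lemma percMeasure_real_open (p : I) (e : G.edgeSet) :
    (percMeasure G p).real {ω | ω e = true} = p := by
  have := percMeasure_forall_open p {e}
  simp only [Finset.mem_singleton, forall_eq, Finset.card_singleton, pow_one] at this
  rw [measureReal_def, this, ENNReal.toReal_ofReal p.2.1]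

end Independence

/-! ### The branching process and percolation on the tree. -/

section BranchingProcess

/-- There is an open non-backtracking walk of `k` steps continuing the oriented edge `x → y`. -/
def ReachesDepth (ω : G.edgeSet → Bool) : ℕ → V → V → Prop
  | 0, _, _ => True
  | k + 1, x, y => ∃ z, (openSubgraph G ω).Adj y z ∧ z ≠ x ∧ ReachesDepth ω k y z

lemma ReachesDepth.of_succ {ω : G.edgeSet → Bool} {k : ℕ} {x y : V}
    (h : ReachesDepth ω (k + 1) x y) : ReachesDepth ω k x y := by
  induction k generalizing x y with
  | zero => trivial
  | succ k ih =>
    obtain ⟨z, hz, hzx, h⟩ := h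
    exact ⟨z, hz, hzx, ih h⟩

lemma ReachesDepth.exists_reachable (hG : G.IsTree) {ω : G.edgeSet → Bool} {k : ℕ} {x y : V}
    (hxy : G.Adj x y) (h : ReachesDepth ω k x y) :
    ∃ w ∈ branch G x y, G.dist w y = k ∧ (openSubgraph G ω).Reachable y w := by
  induction k generalizing x y with
  | zero => exact ⟨y, self_mem_branch hxy, by simp, .rfl⟩
  | succ k ih =>
    obtain ⟨z, hz, hzx, h⟩ := h
    have hyz := openSubgraph_le ω hz
    obtain ⟨w, hw, hd, hr⟩ := ih hyz h
    refine ⟨w, branch_subset hG hxy hyz hzx hw, ?_, hz.reachable.trans hr⟩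
    -- What remains is exactly the definition of `w ∈ branch G y z`.
    rw [← hd]
    exact hw

lemma mem_existsInfiniteCluster (hG : G.IsTree) {ω : G.edgeSet → Bool} {x y : V}
    (hxy : G.Adj x y) (h : ∀ k, ReachesDepth ω k x y) : ω ∈ existsInfiniteCluster G := by
  refine ⟨(openSubgraph G ω).connectedComponentMk y,
    Set.Infinite.of_image (fun w ↦ G.dist w y) ?_⟩
  convert Set.infinite_univ (α := ℕ)
  rw [Set.eq_univ_iff_forall]
  intro k
  obtain ⟨w, -, hd, hr⟩ := (h k).exists_reachable hG hxy
  exact ⟨w, SimpleGraph.ConnectedComponent.sound hr.symm, hd⟩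

/-- The edge `y z` is open, and continued by an open non-backtracking walk of `k` steps. -/
def plantedEvent (G : SimpleGraph V) (k : ℕ) (y z : V) : Set (G.edgeSet → Bool) :=
  {ω | (openSubgraph G ω).Adj y z ∧ ReachesDepth ω k y z}

lemma plantedEvent_eq {k : ℕ} {y z : V} (hyz : G.Adj y z) : plantedEvent G k y z =
    {ω | ω ⟨s(y, z), hyz⟩ = true} ∩ {ω | ReachesDepth ω k y z} := by
  ext ω
  simp [plantedEvent, openSubgraph_adj, hyz]

lemma measurableSet_plantedEvent {k : ℕ} {y z : V} (hyz : G.Adj y z)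
    (h : MeasurableSet[edgeSigma (branchEdges G y z)]
      {ω : G.edgeSet → Bool | ReachesDepth ω k y z}) :
    MeasurableSet[edgeSigma (plantedEdges G y z)] (plantedEvent G k y z) := by
  rw [plantedEvent_eq hyz]
  exact MeasurableSet.inter (measurableSet_edgeSigma_open (Or.inl rfl))
    (edgeSigma_mono Set.subset_union_right _ h)

variable [G.LocallyFinite]

lemma setOf_reachesDepth_succ [DecidableEq V] (k : ℕ) (x y : V) :
    {ω : G.edgeSet → Bool | ReachesDepth ω (k + 1) x y} =
      ⋃ z ∈ (G.neighborFinset y).erase x, plantedEvent G k y z := by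
  ext ω
  simp only [ReachesDepth, plantedEvent, Set.mem_ofPred_eq, Set.mem_iUnion, Finset.mem_erase,
    SimpleGraph.mem_neighborFinset, exists_prop]
  exact ⟨fun ⟨z, h1, h2, h3⟩ ↦ ⟨z, ⟨h2, openSubgraph_le ω h1⟩, h1, h3⟩,
    fun ⟨z, ⟨h2, _⟩, h1, h3⟩ ↦ ⟨z, h1, h2, h3⟩⟩

lemma measurableSet_reachesDepth (hG : G.IsTree) (k : ℕ) {x y : V} (hxy : G.Adj x y) :
    MeasurableSet[edgeSigma (branchEdges G x y)]
      {ω : G.edgeSet → Bool | ReachesDepth ω k x y} := by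
  classical
  induction k generalizing x y with
  | zero => exact @MeasurableSet.univ _ (edgeSigma (branchEdges G x y))
  | succ k ih =>
    rw [setOf_reachesDepth_succ]
    refine @Finset.measurableSet_biUnion _ _ (edgeSigma (branchEdges G x y)) _ _ fun z hz ↦ ?_
    simp only [Finset.mem_erase, SimpleGraph.mem_neighborFinset] at hz
    exact edgeSigma_mono (plantedEdges_subset hG hxy hz.2 hz.1) _
      (measurableSet_plantedEvent hz.2 (ih hz.2))

lemma measure_plantedEvent (hG : G.IsTree) (p : I) (k : ℕ) {y z : V} (hyz : G.Adj y z) :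
    (percMeasure G p).real (plantedEvent G k y z) =
      p * (percMeasure G p).real {ω | ReachesDepth ω k y z} := by
  rw [plantedEvent_eq hyz, measure_inter_of_disjoint p (S := {⟨s(y, z), hyz⟩})
    (T := branchEdges G y z) ?_ (measurableSet_edgeSigma_open rfl)
    (measurableSet_reachesDepth hG k hyz), percMeasure_real_open]
  rw [Set.disjoint_singleton_left]
  exact fun h ↦ notMem_branch y z (h y (by simp))

/-- The extinction recursion: all children must fail, and their planted edge sets are disjoint. -/
lemma measure_compl_reachesDepth_succ [DecidableEq V] (hG : G.IsTree) (p : I) (k : ℕ) {x y : V} :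
    (percMeasure G p).real {ω | ReachesDepth ω (k + 1) x y}ᶜ =
      ∏ z ∈ (G.neighborFinset y).erase x,
        (1 - p * (percMeasure G p).real {ω | ReachesDepth ω k y z}) := by
  have hadj : ∀ z ∈ (G.neighborFinset y).erase x, G.Adj y z := fun z hz ↦ by
    simpa using Finset.mem_of_mem_erase hz
  have hmeas : ∀ z ∈ (G.neighborFinset y).erase x,
      MeasurableSet[edgeSigma (plantedEdges G y z)] (plantedEvent G k y z) := fun z hz ↦
    measurableSet_plantedEvent (hadj z hz) (measurableSet_reachesDepth hG k (hadj z hz))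
  rw [setOf_reachesDepth_succ, Set.compl_iUnion₂, measure_biInter_of_pairwise_disjoint p _
    (S := fun z ↦ plantedEdges G y z)
    (fun i hi j hj hij ↦ disjoint_plantedEdges hG (hadj i hi) (hadj j hj) hij)
    (fun z hz ↦ MeasurableSet.compl (hmeas z hz))]
  refine Finset.prod_congr rfl fun z hz ↦ ?_
  rw [probReal_compl_eq_one_sub (edgeSigma_le _ _ (hmeas z hz)),
    measure_plantedEvent hG p k (hadj z hz)]

lemma one_sub_pow_le {x : ℝ} (h0 : 0 ≤ x) (h1 : x ≤ 1) (n : ℕ) :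
    (1 - x) ^ n ≤ 1 - n * x + (n * x) ^ 2 := by
  induction n with
  | zero => simp
  | succ n ih =>
    have hn : (0 : ℝ) ≤ n := n.cast_nonneg
    calc (1 - x) ^ (n + 1) = (1 - x) ^ n * (1 - x) := pow_succ _ _
      _ ≤ (1 - n * x + (n * x) ^ 2) * (1 - x) :=
        mul_le_mul_of_nonneg_right ih (by linarith)
      _ ≤ _ := by
        push_cast
        have : 0 ≤ (n : ℝ) * x ^ 2 := by positivity
        have : 0 ≤ (n : ℝ) ^ 2 * x ^ 3 := by positivity
        nlinarith [sq_nonneg x]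

variable {d : ℕ}

/-- A lower bound, uniform in `k`, for the survival up to generation `k` of a supercritical
branching process. -/
lemma le_measure_reachesDepth (hG : G.IsTree) (hreg : G.IsRegularOfDegree d) (p : I) {δ : ℝ}
    (hδ0 : 0 ≤ δ) (hδ1 : δ ≤ 1)
    (hδ : 1 + ((d - 1 : ℕ) * (p : ℝ)) ^ 2 * δ ≤ (d - 1 : ℕ) * (p : ℝ)) (k : ℕ) {x y : V}
    (hxy : G.Adj x y) : δ ≤ (percMeasure G p).real {ω | ReachesDepth ω k x y} := by
  classical
  induction k generalizing x y with
  | zero => simpa [ReachesDepth] using hδ1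
  | succ k ih =>
    have hm : MeasurableSet {ω : G.edgeSet → Bool | ReachesDepth ω (k + 1) x y} :=
      edgeSigma_le _ _ (measurableSet_reachesDepth hG (k + 1) hxy)
    have h1 := probReal_compl_eq_one_sub (μ := percMeasure G p) hm
    rw [measure_compl_reachesDepth_succ hG] at h1
    have h2 : ∏ z ∈ (G.neighborFinset y).erase x,
        (1 - p * (percMeasure G p).real {ω | ReachesDepth ω k y z}) ≤ (1 - p * δ) ^ (d - 1) := by
      rw [← card_neighborFinset_erase hreg hxy, ← Finset.prod_const]
      refine Finset.prod_le_prod (fun z _ ↦ ?_) fun z hz ↦ ?_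
      · exact sub_nonneg.2 (mul_le_one₀ p.2.2 measureReal_nonneg measureReal_le_one)
      · have hyz : G.Adj y z := by simpa using Finset.mem_of_mem_erase hz
        exact sub_le_sub_left (mul_le_mul_of_nonneg_left (ih hyz) p.2.1) _
    have h3 := one_sub_pow_le (mul_nonneg p.2.1 hδ0) (mul_le_one₀ p.2.2 hδ0 hδ1) (d - 1)
    -- With `m = (d - 1) * p`, extinction has probability at most `1 - m * δ + (m * δ) ^ 2`, which
    -- this bounds by `1 - δ`.
    have h4 := mul_le_mul_of_nonneg_right hδ hδ0
    nlinarith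

lemma percProb_pos (hG : G.IsTree) (hreg : G.IsRegularOfDegree d) (p : I)
    (hp : 1 < (d - 1 : ℕ) * (p : ℝ)) : 0 < percProb G p := by
  classical
  obtain ⟨x⟩ := hG.connected.nonempty
  obtain ⟨y, hxy⟩ : ∃ y, G.Adj x y := by
    have : 0 < G.degree x := by
      rw [hreg x]
      by_contra! h
      obtain rfl : d = 0 := by omega
      norm_num at hp
    exact (G.degree_pos_iff_exists_adj x).1 this
  set m := (d - 1 : ℕ) * (p : ℝ) with hm
  -- This value of `δ` solves `1 + m ^ 2 * δ = m`.
  have hδ : 0 < (m - 1) / m ^ 2 := div_pos (by linarith) (by positivity)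
  have hδ1 : (m - 1) / m ^ 2 ≤ 1 := by
    rw [div_le_one (by positivity)]
    nlinarith
  have hbound := fun k ↦ le_measure_reachesDepth hG hreg p hδ.le hδ1
    (by rw [← hm, mul_div_cancel₀ _ (by positivity)]; linarith) k hxy
  have hlim := tendsto_measure_iInter_atTop (μ := percMeasure G p)
    (s := fun k ↦ {ω | ReachesDepth ω k x y})
    (fun k ↦ (edgeSigma_le _ _ (measurableSet_reachesDepth hG k hxy)).nullMeasurableSet)
    (antitone_nat_of_succ_le fun k ω hω ↦ ReachesDepth.of_succ hω) ⟨0, measure_ne_top _ _⟩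
  have hge := ge_of_tendsto' ((ENNReal.tendsto_toReal (measure_ne_top _ _)).comp hlim) hbound
  refine hδ.trans_le (hge.trans (measureReal_mono fun ω hω ↦ ?_))
  exact mem_existsInfiniteCluster hG hxy (by simpa using hω)

lemma criticalThreshold_le_of_isTree (hG : G.IsTree) (hreg : G.IsRegularOfDegree d)
    (hd : 2 ≤ d) : criticalThreshold G ≤ 1 / ((d : ℝ) - 1) := by
  have hd' : (0 : ℝ) < d - 1 := by
    have : (2 : ℝ) ≤ d := by exact_mod_cast hd
    linarith
  refine Real.sSup_le ?_ (by positivity)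
  rintro q ⟨hq, h0⟩
  by_contra! hlt
  refine (percProb_pos hG hreg ⟨q, hq⟩ ?_).ne' h0
  rw [div_lt_iff₀ hd'] at hlt
  rw [Nat.cast_sub (by omega), Nat.cast_one, mul_comm]
  exact hlt

end BranchingProcess

end BondPercolation

theorem theorem2 {V : Type*} [Infinite V] (G : SimpleGraph V) [G.LocallyFinite]
    (hconn : G.Connected) (hqt : G.IsQuasiTransitive) (d : ℕ) (hreg : G.IsRegularOfDegree d) :
    1 / ((d : ℝ) - 1) ≤ BondPercolation.criticalThreshold G ∧
      (BondPercolation.criticalThreshold G = 1 / ((d : ℝ) - 1) ↔ G.IsTree) := by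
  have hd := BondPercolation.two_le_of_isRegularOfDegree hconn hreg
  have hle := BondPercolation.one_div_le_criticalThreshold hconn hreg hd
  refine ⟨hle, fun h ↦ ?_, fun h ↦
    le_antisymm (BondPercolation.criticalThreshold_le_of_isTree h hreg hd) hle⟩
  by_contra hG
  exact (BondPercolation.one_div_lt_criticalThreshold hconn hqt hreg hG).ne' h
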